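/- Let $R$ be a finite commutative ring with $1\neq 0$, and write $R\cong R_1\times\cdots\times R_s$ with each $R_i$ a local ring with maximal ideal $M_i$ (such a decomposition exists and is unique up to order). The unitary Cayley graph $G_R$ has vertex set $R$, with $x,y$ adjacent if and only if $x-y\in R^\times$. The line graph $\mathcal L(G_R)$ has the edges of $G_R$ as its vertices, two distinct edges being adjacent if and only if they share an end-vertex. The energy $E(G)$ of a finite graph $G$ is the sum of the absolute values of the eigenvalues of its adjacency matrix, counted with multiplicity. Then 1. if $|R_i/M_i|=2$ for all $i$, or $R\cong\mathbb F_2^{\,s-1}\times\mathbb F_3$, then $$E(\mathcal L(G_R))=2^{s+1}\left(|R^\times|-1\right)^2;$$ 2. if exactly $t$ of the residue fields $R_i/M_i$ have order $2$, where $1\le t<s$, and $R\not\cong\mathbb F_2^{\,s-1}\times\mathbb F_3$, then $$E(\mathcal L(G_R))=2^{t+1}+2|R|\left(|R^\times|-2\right);$$ 3. if $|R_i/M_i|\ge 3$ for all $i$ and $R\not\cong\mathbb F_3$, then $$E(\mathcal L(G_R))=2|R|\left(|R^\times|-2\right).$$ -/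

import Mathlib

/-- The unitary Cayley graph `G_R = Cay(R, Rˣ)` of a commutative ring `R`: the Cayley graph on the
additive group of `R` with respect to the set of units of `R`. -/
def unitaryCayleyGraph (R : Type*) [CommRing R] : SimpleGraph R :=
  SimpleGraph.addCayley {u : R | IsUnit u}

theorem unitaryCayleyGraph_adj {R : Type*} [CommRing R] [Nontrivial R] (x y : R) :
    (unitaryCayleyGraph R).Adj x y ↔ IsUnit (x - y) := by
  unfold unitaryCayleyGraph
  rw [SimpleGraph.addCayley_adj']
  constructor
  · rintro ⟨-, g, hg, h | h⟩
    · have : x - y = -g := by rw [← h]; ring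
      rw [this]
      exact IsUnit.neg hg
    · have : x - y = g := by rw [h]; ring
      rw [this]
      exact hg
  · intro h
    refine ⟨?_, x - y, h, Or.inr (by ring)⟩
    rintro rfl
    rw [sub_self] at h
    exact not_isUnit_zero h

open Classical in
theorem adjMatrix_isHermitian {V : Type*} (G : SimpleGraph V) :
    (G.adjMatrix ℝ).IsHermitian := by
  unfold Matrix.IsHermitian
  rw [Matrix.conjTranspose_eq_transpose_of_trivial]
  exact G.isSymm_adjMatrix

open Classical in
/-- The energy of a finite graph: the sum of the absolute values of the eigenvalues of its
(real symmetric) adjacency matrix, counted with multiplicity. -/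
noncomputable def graphEnergy {V : Type*} [Finite V] (G : SimpleGraph V) : ℝ :=
  letI : Fintype V := Fintype.ofFinite V
  ∑ i, |(adjMatrix_isHermitian G).eigenvalues i|

open Matrix

/-- The square matrix `M` is similar to the diagonal matrix with entries `f`. -/
def HasSpectrum {V : Type*} [Fintype V] [DecidableEq V] (M : Matrix V V ℝ) (f : V → ℝ) : Prop :=
  ∃ P Q : Matrix V V ℝ, P * Q = 1 ∧ M = P * diagonal f * Q

namespace HasSpectrum

variable {V : Type*} [Fintype V] [DecidableEq V] {M N : Matrix V V ℝ} {f g : V → ℝ}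

theorem roots_charpoly (h : HasSpectrum M f) : M.charpoly.roots = Finset.univ.val.map f := by
  obtain ⟨P, Q, hPQ, rfl⟩ := h
  rw [charpoly_mul_comm, ← mul_assoc, mul_eq_one_comm.1 hPQ, one_mul, charpoly_diagonal,
    Polynomial.roots_prod _ _ (by simp [Finset.prod_ne_zero_iff, Polynomial.X_sub_C_ne_zero])]
  simp

theorem trace_eq (h : HasSpectrum M f) : M.trace = ∑ k, f k := by
  obtain ⟨P, Q, hPQ, rfl⟩ := h
  rw [trace_mul_comm, ← mul_assoc, mul_eq_one_comm.1 hPQ, one_mul, trace_diagonal]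

theorem add_smul_one (h : HasSpectrum M f) (c : ℝ) :
    HasSpectrum (M + c • 1) (fun k => f k + c) := by
  obtain ⟨P, Q, hPQ, rfl⟩ := h
  refine ⟨P, Q, hPQ, ?_⟩
  rw [← diagonal_add, mul_add, add_mul, ← smul_one_eq_diagonal, mul_smul_comm, mul_one,
    smul_mul_assoc, hPQ]

theorem sq (h : HasSpectrum M f) : HasSpectrum (M * M) (fun k => f k * f k) := by
  obtain ⟨P, Q, hPQ, rfl⟩ := h
  refine ⟨P, Q, hPQ, ?_⟩
  rw [← diagonal_mul_diagonal]
  calc P * diagonal f * Q * (P * diagonal f * Q)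
      = P * diagonal f * (Q * P) * diagonal f * Q := by simp only [mul_assoc]
    _ = _ := by rw [mul_eq_one_comm.1 hPQ, mul_one]; simp only [mul_assoc]

/-- A cubic relation satisfied by a diagonalizable matrix is satisfied by its eigenvalues. -/
theorem cubic (h : HasSpectrum M f) {b c : ℝ} (hM : M * M * M = b • (M * M) + c • M) (k : V) :
    f k * f k * f k = b * (f k * f k) + c * f k := by
  obtain ⟨P, Q, hPQ, rfl⟩ := h
  have hQP := mul_eq_one_comm.1 hPQ
  have h1 (X : Matrix V V ℝ) : Q * (P * X) = X := by rw [← mul_assoc, hQP, one_mul]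
  have := congrArg (fun X => Q * X * P) hM
  simp only [mul_assoc, mul_add, add_mul, mul_smul_comm, smul_mul_assoc, h1, hQP, mul_one,
    diagonal_mul_diagonal] at this
  have := congrFun (congrFun this k) k
  simpa [mul_assoc] using this

theorem reindex {W : Type*} [Fintype W] [DecidableEq W] (h : HasSpectrum M f) (e : W ≃ V) :
    HasSpectrum (M.submatrix e e) (f ∘ e) := by
  obtain ⟨P, Q, hPQ, rfl⟩ := h
  refine ⟨P.submatrix e e, Q.submatrix e e, ?_, ?_⟩
  · rw [submatrix_mul_equiv, hPQ, submatrix_one_equiv]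
  · rw [← submatrix_diagonal_equiv, submatrix_mul_equiv, submatrix_mul_equiv]

end HasSpectrum

theorem Matrix.IsHermitian.hasSpectrum {V : Type*} [Fintype V] [DecidableEq V] {M : Matrix V V ℝ}
    (hM : M.IsHermitian) : HasSpectrum M hM.eigenvalues := by
  refine ⟨hM.eigenvectorUnitary, star (hM.eigenvectorUnitary : Matrix V V ℝ), ?_, ?_⟩
  · exact Unitary.mul_star_self_of_mem hM.eigenvectorUnitary.2
  · conv_lhs => rw [hM.spectral_theorem, Unitary.conjStarAlgAut_apply]
    rfl

/-- The tensor product of a finite family of matrices. -/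
def piMatrix {ι : Type*} [Fintype ι] {A : ι → Type*} (M : ∀ i, Matrix (A i) (A i) ℝ) :
    Matrix (∀ i, A i) (∀ i, A i) ℝ :=
  of fun x y => ∏ i, M i (x i) (y i)

section piMatrix

variable {ι : Type*} [Fintype ι] {A : ι → Type*}

theorem piMatrix_mul [DecidableEq ι] [∀ i, Fintype (A i)] (M N : ∀ i, Matrix (A i) (A i) ℝ) :
    piMatrix M * piMatrix N = piMatrix fun i => M i * N i := by
  ext x y
  simp only [piMatrix, mul_apply, of_apply, Finset.prod_univ_sum, Fintype.piFinset_univ,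
    Finset.prod_mul_distrib]

theorem piMatrix_diagonal [∀ i, DecidableEq (A i)] (f : ∀ i, A i → ℝ) :
    piMatrix (fun i => diagonal (f i)) = diagonal fun k => ∏ i, f i (k i) := by
  ext x y
  by_cases h : x = y
  · subst h
    simp [piMatrix]
  · obtain ⟨i, hi⟩ := Function.ne_iff.1 h
    rw [diagonal_apply_ne _ h]
    exact Finset.prod_eq_zero (Finset.mem_univ i) (diagonal_apply_ne _ hi)

theorem HasSpectrum.piMatrix [DecidableEq ι] [∀ i, Fintype (A i)]
    [∀ i, DecidableEq (A i)] {M : ∀ i, Matrix (A i) (A i) ℝ} {f : ∀ i, A i → ℝ}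
    (h : ∀ i, HasSpectrum (M i) (f i)) :
    HasSpectrum (piMatrix M) (fun k => ∏ i, f i (k i)) := by
  choose P Q hPQ hM using h
  refine ⟨_root_.piMatrix P, _root_.piMatrix Q, ?_, ?_⟩
  · rw [piMatrix_mul]
    simp only [hPQ]
    rw [show (fun i => (1 : Matrix (A i) (A i) ℝ)) = fun i => diagonal fun _ => 1 from rfl,
      piMatrix_diagonal]
    simp
  · rw [← piMatrix_diagonal, piMatrix_mul, piMatrix_mul]
    exact congrArg _ (funext hM)

end piMatrix

theorem graphEnergy_eq_sum_eigenvalues {V : Type*} [Fintype V] [DecidableEq V] (G : SimpleGraph V)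
    [DecidableRel G.Adj] (hG : (G.adjMatrix ℝ).IsHermitian) :
    graphEnergy G = ∑ i, |hG.eigenvalues i| := by
  unfold graphEnergy
  convert rfl

/-- The vertex-edge incidence matrix, with columns indexed by the edges. -/
def edgeIncMatrix {V : Type*} [DecidableEq V] (G : SimpleGraph V) : Matrix V G.edgeSet ℝ :=
  of fun v e => if v ∈ (e : Sym2 V) then 1 else 0

section lineGraph

variable {V : Type*} [Fintype V] [DecidableEq V] (G : SimpleGraph V)

theorem edgeIncMatrix_mul_transpose [DecidableRel G.Adj] {d : ℕ} (hd : G.IsRegularOfDegree d) :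
    edgeIncMatrix G * (edgeIncMatrix G)ᵀ = G.adjMatrix ℝ + (d : ℝ) • 1 := by
  have key : edgeIncMatrix G * (edgeIncMatrix G)ᵀ = G.incMatrix ℝ * (G.incMatrix ℝ)ᵀ := by
    ext a b
    simp only [mul_apply, transpose_apply, edgeIncMatrix, of_apply]
    rw [← Finset.sum_subset (Finset.subset_univ G.edgeFinset)]
    · rw [← Finset.sum_coe_sort G.edgeFinset]
      refine Fintype.sum_equiv (κ := G.edgeFinset) (M := ℝ)
        (Equiv.subtypeEquivRight fun e => SimpleGraph.mem_edgeFinset.symm) _ _ fun e => ?_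
      have := e.2
      simp [SimpleGraph.incMatrix_apply', SimpleGraph.incidenceSet]
    · intro e _ he
      rw [SimpleGraph.mem_edgeFinset] at he
      rw [G.incMatrix_of_notMem_incidenceSet (fun h => he h.1), zero_mul]
  rw [key, SimpleGraph.incMatrix_mul_transpose]
  ext a b
  simp only [of_apply, Matrix.add_apply, SimpleGraph.adjMatrix_apply, Matrix.smul_apply, one_apply, smul_eq_mul]
  split_ifs with h1 h2 <;> simp_all [hd.degree_eq]

theorem transpose_mul_edgeIncMatrix [DecidableRel G.lineGraph.Adj] :
    (edgeIncMatrix G)ᵀ * edgeIncMatrix G = G.lineGraph.adjMatrix ℝ + (2 : ℝ) • 1 := by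
  ext ⟨e, he⟩ ⟨e', he'⟩
  induction e with | _ a b
  have hab : a ≠ b := G.ne_of_adj he
  have key : ((edgeIncMatrix G)ᵀ * edgeIncMatrix G) ⟨s(a, b), he⟩ ⟨e', he'⟩
      = (if a ∈ e' then 1 else 0) + if b ∈ e' then 1 else 0 := by
    simp only [mul_apply, transpose_apply, edgeIncMatrix, of_apply, Sym2.mem_iff, ite_mul, one_mul,
      zero_mul]
    rw [← Finset.sum_filter, show Finset.univ.filter (fun v => v = a ∨ v = b) = {a, b} by
      ext; simp, Finset.sum_pair hab]
  rw [key]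
  simp only [Matrix.add_apply, SimpleGraph.adjMatrix_apply, Matrix.smul_apply, one_apply, smul_eq_mul,
    SimpleGraph.lineGraph_adj_iff_exists, Sym2.mem_iff, ne_eq, Subtype.mk.injEq]
  by_cases h : s(a, b) = e'
  · subst h
    norm_num
  · have h2 : ¬ (a ∈ e' ∧ b ∈ e') := fun h2 => h ((Sym2.mem_and_mem_iff hab).1 h2).symm
    by_cases ha : a ∈ e' <;> by_cases hb : b ∈ e' <;> simp_all

/-- The energy of the line graph of a regular graph in terms of the spectrum of the graph. -/
theorem graphEnergy_lineGraph [DecidableRel G.Adj] {d : ℕ} (hd : G.IsRegularOfDegree d) {f : V → ℝ}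
    (hf : HasSpectrum (G.adjMatrix ℝ) f) :
    graphEnergy G.lineGraph = Fintype.card V * ((d : ℝ) - 2) + ∑ k, |f k + d - 2| := by
  classical
  have hL : (G.lineGraph.adjMatrix ℝ).IsHermitian := by convert adjMatrix_isHermitian G.lineGraph
  rw [graphEnergy_eq_sum_eigenvalues _ hL]
  have h1 := (hL.hasSpectrum.add_smul_one 2).roots_charpoly
  have h2 := (hf.add_smul_one d).roots_charpoly
  have h3 := congrArg Polynomial.roots (charpoly_mul_comm' (edgeIncMatrix G) (edgeIncMatrix G)ᵀ)
  rw [transpose_mul_edgeIncMatrix, edgeIncMatrix_mul_transpose G hd,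
    Polynomial.roots_mul (mul_ne_zero (pow_ne_zero _ Polynomial.X_ne_zero)
      (charpoly_monic _).ne_zero),
    Polynomial.roots_mul (mul_ne_zero (pow_ne_zero _ Polynomial.X_ne_zero)
      (charpoly_monic _).ne_zero), h1, h2] at h3
  have h4 := congrArg (fun s => (s.map fun x : ℝ => |x - 2| - 2).sum) h3
  have h5 : (Fintype.card V * d : ℝ) = 2 * Fintype.card G.edgeSet := by
    have := G.sum_degrees_eq_twice_card_edges
    simp only [hd.degree_eq, Finset.sum_const, Finset.card_univ, smul_eq_mul] at this
    rw [← SimpleGraph.edgeFinset_card]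
    exact_mod_cast this
  simp only [Polynomial.roots_X_pow, Multiset.map_add, Multiset.sum_add, Multiset.map_nsmul,
    Multiset.map_singleton, Multiset.sum_nsmul, Multiset.sum_singleton, Multiset.map_map,
    Function.comp_def, add_sub_cancel_right, zero_sub, abs_neg, Nat.abs_ofNat, sub_self, smul_zero,
    zero_add, Finset.sum_map_val, Finset.sum_sub_distrib, Finset.sum_const, Finset.card_univ,
    nsmul_eq_mul] at h4
  linarith

end lineGraph

/-- The units of a monoid as a subtype. -/
noncomputable def unitsEquivSubtypeIsUnit (R : Type*) [Monoid R] : Rˣ ≃ {x : R // IsUnit x} :=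
  Equiv.ofBijective (fun u => ⟨u, u.isUnit⟩)
    ⟨fun _ _ h => Units.ext (Subtype.mk.inj h), fun x => ⟨x.2.unit, rfl⟩⟩

section local_ring

variable {A : Type*} [CommRing A] [IsLocalRing A]

theorem natCard_eq_residueField_mul_maximalIdeal :
    Nat.card A = Nat.card (IsLocalRing.ResidueField A) * Nat.card (IsLocalRing.maximalIdeal A) :=
  AddSubgroup.card_eq_card_quotient_mul_card_addSubgroup
    (IsLocalRing.maximalIdeal A).toAddSubgroup

theorem natCard_units_add_natCard_maximalIdeal [Finite A] :
    Nat.card Aˣ + Nat.card (IsLocalRing.maximalIdeal A) = Nat.card A := by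
  classical
  rw [Nat.card_congr (unitsEquivSubtypeIsUnit A), ← Nat.card_sum]
  refine Nat.card_congr ((Equiv.sumCongr (Equiv.refl _) (Equiv.subtypeEquivRight fun a => ?_)).trans
    (Equiv.sumCompl fun a : A => IsUnit a))
  rw [IsLocalRing.mem_maximalIdeal, mem_nonunits_iff]

end local_ring

/-- A unitary Cayley graph is regular. -/
theorem sum_ite_isUnit_sub {R : Type*} [CommRing R] [Fintype R] [DecidablePred (IsUnit (M := R))]
    (x : R) : ∑ y, (if IsUnit (x - y) then (1 : ℝ) else 0) = Nat.card Rˣ := by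
  refine ((Equiv.subLeft x).sum_comp fun z => if IsUnit z then (1 : ℝ) else 0).trans ?_
  rw [Finset.sum_boole, Nat.card_congr (unitsEquivSubtypeIsUnit R),
    Nat.card_eq_fintype_card, Fintype.card_subtype]

/-- The number of common neighbours in the unitary Cayley graph of a local ring. -/
theorem sum_isUnit_sub_mul_isUnit_sub {A : Type*} [CommRing A] [IsLocalRing A] [Fintype A]
    [DecidablePred (IsUnit (M := A))] (x y : A) :
    ∑ z, (if IsUnit (x - z) then (1 : ℝ) else 0) * (if IsUnit (z - y) then 1 else 0)
      = Nat.card Aˣ - Nat.card (IsLocalRing.maximalIdeal A) * if IsUnit (x - y) then 1 else 0 := by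
  have h (z : A) : (if IsUnit (x - z) then (1 : ℝ) else 0) * (if IsUnit (z - y) then 1 else 0)
      = (if IsUnit (x - z) then (1 : ℝ) else 0)
        - (if IsUnit (x - y) then 1 else 0) * (if ¬ IsUnit (z - y) then 1 else 0) := by
    by_cases hz : IsUnit (z - y)
    · simp [hz]
    · have : IsUnit (x - z) ↔ IsUnit (x - y) := by
        have h1 := IsLocalRing.nonunits_add (a := x - z) (b := z - y)
        have h2 := IsLocalRing.nonunits_add (a := x - y) (b := -(z - y))
        simp only [mem_nonunits_iff, sub_add_sub_cancel, IsUnit.neg_iff] at h1 h2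
        rw [show x - y + -(z - y) = x - z by ring] at h2
        tauto
      simp [hz, this]
  simp only [h, Finset.sum_sub_distrib, sum_ite_isUnit_sub, ← Finset.mul_sum]
  have h' := (Equiv.subRight y).sum_comp fun z => if ¬ IsUnit z then (1 : ℝ) else 0
  simp only [Equiv.subRight_apply] at h'
  rw [h', Finset.sum_boole, mul_comm, ← Fintype.card_subtype, ← Nat.card_eq_fintype_card]
  rfl

/-- The spectrum of the unitary Cayley graph of a finite local ring with unit group of order `d`,
maximal ideal of order `m` and residue field of order `q`. -/
theorem exists_hasSpectrum_of_isLocalRing {A : Type*} [CommRing A] [IsLocalRing A] [Fintype A]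
    [DecidableEq A] [DecidableRel (unitaryCayleyGraph A).Adj] {d m q : ℕ} (hd : Nat.card Aˣ = d)
    (hm : Nat.card (IsLocalRing.maximalIdeal A) = m)
    (hq : Nat.card (IsLocalRing.ResidueField A) = q) :
    ∃ f : A → ℝ, HasSpectrum ((unitaryCayleyGraph A).adjMatrix ℝ) f ∧
      (∀ k, f k = d ∨ f k = -m ∨ f k = 0) ∧
      ∑ k, (if f k = d then (1 : ℝ) else 0) = 1 ∧
      ∑ k, (if f k = -m then (1 : ℝ) else 0) = q - 1 := by
  classical
  have hH : ((unitaryCayleyGraph A).adjMatrix ℝ).IsHermitian := by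
    convert adjMatrix_isHermitian (unitaryCayleyGraph A)
  obtain ⟨f, hf⟩ : ∃ f, HasSpectrum ((unitaryCayleyGraph A).adjMatrix ℝ) f := ⟨_, hH.hasSpectrum⟩
  have hA1 := natCard_eq_residueField_mul_maximalIdeal (A := A)
  have hA2 := natCard_units_add_natCard_maximalIdeal (A := A)
  have hd0 : 0 < d := hd ▸ Nat.card_pos
  have hm0 : 0 < m := hm ▸ Nat.card_pos
  rw [hq, hm] at hA1
  rw [hd, hm, hA1] at hA2
  have hA2' : (d : ℝ) + m = q * m := by exact_mod_cast hA2
  have hd0' : (0 : ℝ) < d := by exact_mod_cast hd0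
  have hm0' : (0 : ℝ) < m := by exact_mod_cast hm0
  set M := (unitaryCayleyGraph A).adjMatrix ℝ with hM
  have hMapp (x y : A) : M x y = if IsUnit (x - y) then 1 else 0 := by
    simp [hM, SimpleGraph.adjMatrix_apply, unitaryCayleyGraph_adj]
  let J : Matrix A A ℝ := of fun _ _ => 1
  have hMM : M * M = (d : ℝ) • J - (m : ℝ) • M := by
    ext x y
    simp only [mul_apply, hMapp, sum_isUnit_sub_mul_isUnit_sub, hd, hm, Matrix.sub_apply,
      Matrix.smul_apply, smul_eq_mul, J, of_apply, mul_one]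
  have hMJ : M * J = (d : ℝ) • J := by
    ext x y
    simp only [mul_apply, hMapp, J, of_apply, mul_one, sum_ite_isUnit_sub, hd, Matrix.smul_apply,
      smul_eq_mul]
  have hMMM : M * M * M = ((d : ℝ) - m) • (M * M) + ((d : ℝ) * m) • M := by
    rw [mul_assoc]
    simp only [hMM, mul_sub, mul_smul_comm, hMJ]
    module
  have hval (k : A) : f k = d ∨ f k = -m ∨ f k = 0 := by
    have h : (f k - d) * ((f k + m) * f k) = 0 := by linear_combination hf.cubic hMMM k
    rcases mul_eq_zero.1 h with h | h
    · exact Or.inl (sub_eq_zero.1 h)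
    · rcases mul_eq_zero.1 h with h | h
      · exact Or.inr (Or.inl (eq_neg_of_add_eq_zero_left h))
      · exact Or.inr (Or.inr h)
  have htr : ∑ k, f k = 0 := by
    rw [← hf.trace_eq]
    simp [hM]
  have htr2 : ∑ k, f k * f k = q * m * d := by
    rw [← hf.sq.trace_eq, hMM]
    have : (Fintype.card A : ℝ) = q * m := by
      rw [← Nat.card_eq_fintype_card]; exact_mod_cast hA1
    simp [J, hM, trace, this]
  set a := ∑ k, (if f k = d then (1 : ℝ) else 0) with ha
  set b := ∑ k, (if f k = -m then (1 : ℝ) else 0) with hb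
  have e1 : ∑ k, f k = d * a - m * b := by
    rw [ha, hb, Finset.mul_sum, Finset.mul_sum, ← Finset.sum_sub_distrib]
    refine Finset.sum_congr rfl fun k _ => ?_
    have h1 : ¬ (-(m : ℝ) = d) := by linarith
    have h2 : ¬ ((d : ℝ) = -m) := by linarith
    have h3 : ¬ ((0 : ℝ) = -m) := by linarith
    rcases hval k with h | h | h <;> simp [h, h1, h2, h3, hd0'.ne]
  have e2 : ∑ k, f k * f k = d ^ 2 * a + m ^ 2 * b := by
    rw [ha, hb, Finset.mul_sum, Finset.mul_sum, ← Finset.sum_add_distrib]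
    refine Finset.sum_congr rfl fun k _ => ?_
    have h1 : ¬ (-(m : ℝ) = d) := by linarith
    have h2 : ¬ ((d : ℝ) = -m) := by linarith
    have h3 : ¬ ((0 : ℝ) = -m) := by linarith
    rcases hval k with h | h | h <;> simp [h, h1, h2, h3, hd0'.ne, sq]
  rw [htr] at e1
  rw [htr2] at e2
  have hqm : (d : ℝ) = (q - 1) * m := by linarith
  have ha1 : a = 1 := by
    have h : ((q : ℝ) * m * d) * (a - 1) = 0 := by
      rw [← hA2']; linear_combination -(m : ℝ) * e1 - e2 - (d : ℝ) * hA2'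
    have hpos : (0 : ℝ) < q * m * d := by rw [← hA2']; positivity
    rcases mul_eq_zero.1 h with h | h
    · exact absurd h hpos.ne'
    · linarith
  refine ⟨f, hf, hval, ha1, ?_⟩
  rw [ha1, hqm] at e1
  have : (m : ℝ) * (b - (q - 1)) = 0 := by linarith
  rcases mul_eq_zero.1 this with h | h
  · exact absurd h hm0'.ne'
  · linarith

/-- The spectral sums of the unitary Cayley graph of a finite local ring. -/
theorem exists_hasSpectrum_sums_of_isLocalRing {A : Type*} [CommRing A] [IsLocalRing A] [Fintype A]
    [DecidableEq A] [DecidableRel (unitaryCayleyGraph A).Adj] {d q : ℕ} (hd : Nat.card Aˣ = d)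
    (hq : Nat.card (IsLocalRing.ResidueField A) = q) :
    ∃ f : A → ℝ, HasSpectrum ((unitaryCayleyGraph A).adjMatrix ℝ) f ∧
      (∀ k, ∃ z : ℤ, f k = z) ∧ (∀ k, |f k| = d ∨ |f k| ≤ d / 2) ∧
      ∑ k, f k = 0 ∧ ∑ k, |f k| = 2 * d ∧
      ∑ k, (if |f k| = d then (1 : ℝ) else 0) = (if q = 2 then 2 else 1) ∧
      ∑ k, (if |f k| = d then f k else 0) = (if q = 2 then 0 else (d : ℝ)) := by
  classical
  obtain ⟨m, hm⟩ : ∃ m, Nat.card (IsLocalRing.maximalIdeal A) = m := ⟨_, rfl⟩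
  obtain ⟨f, hf, hval, ha, hb⟩ := exists_hasSpectrum_of_isLocalRing hd hm hq
  have hA1 := natCard_eq_residueField_mul_maximalIdeal (A := A)
  have hA2 := natCard_units_add_natCard_maximalIdeal (A := A)
  have hd0 : 0 < d := hd ▸ Nat.card_pos
  have hm0 : 0 < m := hm ▸ Nat.card_pos
  have hq2 : 2 ≤ q := by
    have : Finite (IsLocalRing.ResidueField A) :=
      Finite.of_surjective _ (IsLocalRing.residue_surjective (R := A))
    have := Finite.one_lt_card (α := IsLocalRing.ResidueField A)
    omega
  rw [hq, hm] at hA1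
  rw [hd, hm, hA1] at hA2
  have hdm : (d : ℝ) = (q - 1) * m := by
    have : (d : ℝ) + m = q * m := by exact_mod_cast hA2
    linarith
  have hd0' : (0 : ℝ) < d := by exact_mod_cast hd0
  have hm0' : (0 : ℝ) < m := by exact_mod_cast hm0
  have h1 : ¬ (-(m : ℝ) = d) := by linarith
  have h2 : ¬ ((d : ℝ) = -m) := by linarith
  have h3 : ¬ ((0 : ℝ) = -m) := by linarith
  have key (g : ℝ → ℝ) (hg : g 0 = 0) : ∑ k, g (f k) = g d + (q - 1) * g (-m) := by
    trans g d * (∑ k, if f k = d then (1 : ℝ) else 0) + g (-m) * ∑ k, if f k = -m then (1 : ℝ) else 0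
    swap
    · rw [ha, hb]; ring
    rw [Finset.mul_sum, Finset.mul_sum, ← Finset.sum_add_distrib]
    refine Finset.sum_congr rfl fun k _ => ?_
    rcases hval k with h | h | h <;> simp [h, h1, h2, h3, hd0'.ne, hg]
  refine ⟨f, hf, fun k => ?_, fun k => ?_, ?_, ?_, ?_, ?_⟩
  · rcases hval k with h | h | h
    · exact ⟨d, by simp [h]⟩
    · exact ⟨-m, by simp [h]⟩
    · exact ⟨0, by simp [h]⟩
  · rcases hval k with h | h | h
    · left; simp [h]
    · rcases hq2.eq_or_lt with h5 | h5
      · left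
        rw [h, hdm, ← h5]
        norm_num
      · right
        have : (3 : ℝ) ≤ q := by exact_mod_cast h5
        rw [h, hdm, abs_neg, Nat.abs_cast]
        nlinarith
    · right
      rw [h, abs_zero]
      positivity
  · rw [key (fun x => x) rfl, hdm]; ring
  · rw [key (fun x => |x|) abs_zero, abs_neg, Nat.abs_cast, Nat.abs_cast, hdm]; ring
  · rw [key (fun x => if |x| = d then 1 else 0) (by simp [hd0'.ne])]
    rcases hq2.eq_or_lt with h5 | h5
    · subst h5
      have : (m : ℝ) = d := by rw [hdm]; norm_num
      norm_num [this]
    · have : (3 : ℝ) ≤ q := by exact_mod_cast h5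
      have h6 : (m : ℝ) ≠ d := by nlinarith
      simp [h6, h5.ne']
  · rw [key (fun x => if |x| = d then x else 0) (by simp)]
    rcases hq2.eq_or_lt with h5 | h5
    · subst h5
      have : (m : ℝ) = d := by rw [hdm]; norm_num
      norm_num [this]
    · have : (3 : ℝ) ≤ q := by exact_mod_cast h5
      have h6 : (m : ℝ) ≠ d := by nlinarith
      simp [h6, h5.ne']

theorem prod_le_half_of_exists_le_half {ι : Type*} [Fintype ι] {a d : ι → ℝ} (ha : ∀ i, 0 ≤ a i)
    (had : ∀ i, a i ≤ d i) {j : ι} (hj : a j ≤ d j / 2) : ∏ i, a i ≤ (∏ i, d i) / 2 := by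
  classical
  rw [← Finset.mul_prod_erase _ _ (Finset.mem_univ j),
    ← Finset.mul_prod_erase _ d (Finset.mem_univ j), mul_div_right_comm]
  exact mul_le_mul hj (Finset.prod_le_prod (fun i _ => ha i) fun i _ => had i)
    (Finset.prod_nonneg fun i _ => ha i) ((ha j).trans hj)

theorem natCard_units_eq_prod {R ι : Type*} [Fintype ι] [CommRing R] {A : ι → Type*}
    [∀ i, CommRing (A i)] (e : R ≃+* ((i : ι) → A i)) :
    Nat.card Rˣ = ∏ i, Nat.card (A i)ˣ := by
  rw [Nat.card_congr ((Units.mapEquiv e.toMulEquiv).trans MulEquiv.piUnits).toEquiv, Nat.card_pi]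

theorem adjMatrix_unitaryCayleyGraph_eq_submatrix {R ι : Type*} [Fintype ι] [CommRing R]
    [Nontrivial R] {A : ι → Type*} [∀ i, CommRing (A i)] [∀ i, Nontrivial (A i)]
    [DecidableRel (unitaryCayleyGraph R).Adj] [∀ i, DecidableRel (unitaryCayleyGraph (A i)).Adj]
    (e : R ≃+* ((i : ι) → A i)) :
    (unitaryCayleyGraph R).adjMatrix ℝ
      = (piMatrix fun i => (unitaryCayleyGraph (A i)).adjMatrix ℝ).submatrix
        e.toEquiv e.toEquiv := by
  ext x y
  simp only [SimpleGraph.adjMatrix_apply, submatrix_apply, piMatrix,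
    of_apply, Finset.prod_ite_zero, Finset.prod_const_one, Finset.mem_univ, true_imp_iff]
  have : IsUnit (x - y) ↔ ∀ i, IsUnit (e x i - e y i) := by
    rw [← MulEquiv.isUnit_map e.toMulEquiv, Pi.isUnit_iff]
    simp
  refine if_congr ?_ rfl rfl
  simpa [unitaryCayleyGraph_adj] using this

/-- The spectral sums of the unitary Cayley graph of a finite commutative ring, decomposed into
local rings. -/
theorem exists_hasSpectrum_sums {R : Type*} [CommRing R] [Fintype R] [DecidableEq R] [Nontrivial R]
    [DecidableRel (unitaryCayleyGraph R).Adj] {s t d : ℕ} {A : Fin s → Type*}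
    [∀ i, CommRing (A i)] [∀ i, IsLocalRing (A i)] (e : R ≃+* ((i : Fin s) → A i))
    (ht : Nat.card {i : Fin s // Nat.card (IsLocalRing.ResidueField (A i)) = 2} = t)
    (hd : Nat.card Rˣ = d) :
    ∃ f : R → ℝ, HasSpectrum ((unitaryCayleyGraph R).adjMatrix ℝ) f ∧
      (∀ k, ∃ z : ℤ, f k = z) ∧ (∀ k, |f k| = d ∨ |f k| ≤ d / 2) ∧
      ∑ k, f k = 0 ∧ ∑ k, |f k| = 2 ^ s * d ∧
      ∑ k, (if |f k| = d then (1 : ℝ) else 0) = 2 ^ t ∧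
      ∑ k, (if |f k| = d then f k else 0) = (if t = 0 then (d : ℝ) else 0) := by
  classical
  have hfin : Finite (∀ i, A i) := Finite.of_equiv R e.toEquiv
  have (i : Fin s) : Finite (A i) :=
    Finite.of_surjective _ (Function.surjective_eval (β := A) i)
  have (i : Fin s) : Fintype (A i) := Fintype.ofFinite _
  have hs : Nonempty (Fin s) := by
    by_contra h
    rw [not_nonempty_iff] at h
    exact not_subsingleton R (e.toEquiv.subsingleton)
  choose f hf hint hval hsum habs hone hsgn using fun i =>
    exists_hasSpectrum_sums_of_isLocalRing (A := A i) rfl rfl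
  let δ : Fin s → ℝ := fun i => (Nat.card (A i)ˣ : ℝ)
  have hδ : ∏ i, δ i = d := by
    rw [← hd, natCard_units_eq_prod e]; simp [δ]
  have hδ0 (i : Fin s) : 0 < δ i := Nat.cast_pos.2 Nat.card_pos
  have hle (i : Fin s) (k : A i) : |f i k| ≤ δ i := by
    rcases hval i k with h | h
    · exact h.le
    · have := hδ0 i; simp only [δ] at *; linarith
  have hd0 : (0 : ℝ) < d := hδ ▸ Finset.prod_pos fun i _ => hδ0 i
  have hhalf (k : ∀ i, A i) (h : ¬ ∀ i, |f i (k i)| = δ i) : |∏ i, f i (k i)| ≤ d / 2 := by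
    obtain ⟨i, hi⟩ := not_forall.1 h
    rw [Finset.abs_prod, ← hδ]
    exact prod_le_half_of_exists_le_half (fun i => abs_nonneg _) (fun i => hle i _)
      ((hval i (k i)).resolve_left hi)
  have hfull (k : ∀ i, A i) (h : ∀ i, |f i (k i)| = δ i) : |∏ i, f i (k i)| = d := by
    rw [Finset.abs_prod, ← hδ]
    exact Finset.prod_congr rfl fun i _ => h i
  have hiff (k : ∀ i, A i) : |∏ i, f i (k i)| = d ↔ ∀ i, |f i (k i)| = δ i := by
    refine ⟨fun h => ?_, hfull k⟩
    by_contra h'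
    have := hhalf k h'
    linarith
  have hpi (g : ∀ i, A i → ℝ) : ∑ k : ∀ i, A i, ∏ i, g i (k i) = ∏ i, ∑ a, g i a := by
    rw [Finset.prod_univ_sum, Fintype.piFinset_univ]
  have hcomp (g : (∀ i, A i) → ℝ) : ∑ k : R, g (e.toEquiv k) = ∑ k, g k := e.toEquiv.sum_comp g
  have ht' : (Finset.univ.filter fun i => Nat.card (IsLocalRing.ResidueField (A i)) = 2).card = t := by
    rw [← ht, Nat.card_eq_fintype_card, Fintype.card_subtype]
  refine ⟨fun k => ∏ i, f i (e.toEquiv k i), ?_, fun k => ?_, fun k => ?_, ?_, ?_, ?_, ?_⟩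
  · rw [adjMatrix_unitaryCayleyGraph_eq_submatrix e]
    exact (HasSpectrum.piMatrix hf).reindex e.toEquiv
  · choose z hz using fun i => hint i (e.toEquiv k i)
    exact ⟨∏ i, z i, by push_cast; exact Finset.prod_congr rfl fun i _ => hz i⟩
  · by_cases h : ∀ i, |f i (e.toEquiv k i)| = δ i
    · exact Or.inl (hfull _ h)
    · exact Or.inr (hhalf _ h)
  · rw [hcomp fun k => ∏ i, f i (k i), hpi]
    exact Finset.prod_eq_zero (Finset.mem_univ hs.some) (hsum _)
  · rw [hcomp fun k => |∏ i, f i (k i)|]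
    simp only [Finset.abs_prod]
    rw [hpi fun i a => |f i a|]
    simp only [habs]
    rw [Finset.prod_mul_distrib, Finset.prod_const, Finset.card_univ, Fintype.card_fin, hδ]
  · rw [hcomp fun k => if |∏ i, f i (k i)| = d then (1 : ℝ) else 0]
    have (k : ∀ i, A i) : (if |∏ i, f i (k i)| = d then (1 : ℝ) else 0)
        = ∏ i, if |f i (k i)| = δ i then 1 else 0 := by
      rw [Finset.prod_ite_zero]
      simp [hiff]
    simp only [this]
    rw [hpi fun i a => if |f i a| = δ i then 1 else 0]
    simp only [δ, hone]
    rw [← Finset.prod_filter, Finset.prod_const, ht']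
  · rw [hcomp fun k => if |∏ i, f i (k i)| = d then ∏ i, f i (k i) else 0]
    have (k : ∀ i, A i) : (if |∏ i, f i (k i)| = d then ∏ i, f i (k i) else 0)
        = ∏ i, if |f i (k i)| = δ i then f i (k i) else 0 := by
      rw [Finset.prod_ite_zero]
      simp [hiff]
    simp only [this]
    rw [hpi fun i a => if |f i a| = δ i then f i a else 0]
    simp only [δ, hsgn]
    split_ifs with h
    · rw [← hδ]
      refine Finset.prod_congr rfl fun i _ => if_neg fun hi => ?_
      rw [h, Finset.card_eq_zero] at ht'
      exact Finset.notMem_empty i (ht' ▸ Finset.mem_filter.2 ⟨Finset.mem_univ i, hi⟩)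
    · obtain ⟨i, hi⟩ := Finset.card_pos.1 (ht' ▸ Nat.pos_of_ne_zero h)
      exact Finset.prod_eq_zero (Finset.mem_univ i) (if_pos (Finset.mem_filter.1 hi).2)

/-- The number of neighbours of a vertex in a unitary Cayley graph. -/
theorem isRegularOfDegree_unitaryCayleyGraph {R : Type*} [CommRing R] [Fintype R] [Nontrivial R]
    [DecidableRel (unitaryCayleyGraph R).Adj] :
    (unitaryCayleyGraph R).IsRegularOfDegree (Nat.card Rˣ) := by
  classical
  intro x
  have := sum_ite_isUnit_sub x
  rw [Finset.sum_boole] at this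
  rw [← SimpleGraph.card_neighborFinset_eq_degree, ← Nat.cast_inj (R := ℝ), ← this]
  congr 2
  ext y
  simp [unitaryCayleyGraph_adj]

/-- The energy of the line graph of a unitary Cayley graph, in terms of the order `d` of the unit
group, the number `s` of local factors and the number `t` of those with residue field of
order two. -/
theorem graphEnergy_lineGraph_unitaryCayleyGraph {R : Type*} [CommRing R] [Finite R] [Nontrivial R]
    {s t d : ℕ} {A : Fin s → Type*} [∀ i, CommRing (A i)] [∀ i, IsLocalRing (A i)]
    (e : R ≃+* ((i : Fin s) → A i))
    (ht : Nat.card {i : Fin s // Nat.card (IsLocalRing.ResidueField (A i)) = 2} = t)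
    (hd : Nat.card Rˣ = d) :
    (d = 1 → graphEnergy (unitaryCayleyGraph R).lineGraph = 0) ∧
    (d = 2 → graphEnergy (unitaryCayleyGraph R).lineGraph = 2 ^ (s + 1)) ∧
    (3 ≤ d → graphEnergy (unitaryCayleyGraph R).lineGraph
      = 2 * Nat.card R * ((d : ℝ) - 2) + 2 ^ (t + 1) - if t = 0 then 2 else 0) := by
  classical
  have := Fintype.ofFinite R
  obtain ⟨f, hf, hint, hval, hsum, habs, hone, hsgn⟩ := exists_hasSpectrum_sums e ht hd
  have hreg := isRegularOfDegree_unitaryCayleyGraph (R := R)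
  rw [hd] at hreg
  rw [graphEnergy_lineGraph _ hreg hf, ← Nat.card_eq_fintype_card]
  refine ⟨?_, ?_, ?_⟩
  · rintro rfl
    have (k : R) : |f k + (1 : ℕ) - 2| = 1 - f k := by
      have : |f k| ≤ 1 := by rcases hval k with h | h <;> norm_num at h <;> linarith
      rw [abs_of_nonpos] <;> push_cast <;> linarith [le_abs_self (f k)]
    simp only [this, Finset.sum_sub_distrib, hsum]
    simp
    ring
  · rintro rfl
    simp only [Nat.cast_ofNat, sub_self, mul_zero, add_sub_cancel_right, habs, zero_add]
    ring
  · intro hd3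
    have hd3' : (3 : ℝ) ≤ d := by exact_mod_cast hd3
    have (k : R) : |f k + d - 2| = f k + (d - 2)
        + (2 * (if |f k| = d then 1 else 0) - 2 / d * if |f k| = d then f k else 0) := by
      rcases hval k with h | h
      · rw [if_pos h, if_pos h]
        rcases (abs_eq (by linarith)).1 h with h' | h' <;> rw [h']
        · rw [abs_of_nonneg (by linarith)]
          field_simp
          ring
        · rw [abs_of_nonpos (by linarith)]
          field_simp
          ring
      · rw [if_neg (by linarith), if_neg (by linarith), abs_of_nonneg]
        · ring
        · obtain ⟨z, hz⟩ := hint k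
          have h1 : -f k ≤ d / 2 := (neg_le_abs _).trans h
          have h2 : (-(2 * z) : ℤ) ≤ d := by
            have : (-(2 * z) : ℝ) ≤ d := by linarith
            exact_mod_cast this
          have h3 : (2 : ℤ) ≤ z + d := by omega
          have h4 : (2 : ℝ) ≤ z + d := by exact_mod_cast h3
          linarith
    simp only [this, Finset.sum_add_distrib, Finset.sum_sub_distrib, ← Finset.mul_sum, hsum, hone,
      hsgn, Finset.sum_const, Finset.card_univ, nsmul_eq_mul, Nat.card_eq_fintype_card]
    split_ifs with h
    · subst h
      field_simp
      ring
    · ring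

theorem one_lt_natCard_residueField (A : Type*) [CommRing A] [IsLocalRing A] [Finite A] :
    1 < Nat.card (IsLocalRing.ResidueField A) := by
  have : Finite (IsLocalRing.ResidueField A) :=
    Finite.of_surjective _ (IsLocalRing.residue_surjective (R := A))
  exact Finite.one_lt_card

theorem natCard_units_eq_mul_natCard_maximalIdeal (A : Type*) [CommRing A] [IsLocalRing A]
    [Finite A] : Nat.card Aˣ
      = (Nat.card (IsLocalRing.ResidueField A) - 1) * Nat.card (IsLocalRing.maximalIdeal A) := by
  have h1 := natCard_eq_residueField_mul_maximalIdeal (A := A)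
  have h2 := natCard_units_add_natCard_maximalIdeal (A := A)
  rw [Nat.sub_mul, one_mul]
  omega

theorem two_le_natCard_units {A : Type*} [CommRing A] [IsLocalRing A] [Finite A]
    (h : 3 ≤ Nat.card (IsLocalRing.ResidueField A)) : 2 ≤ Nat.card Aˣ := by
  rw [natCard_units_eq_mul_natCard_maximalIdeal]
  have hm : 0 < Nat.card (IsLocalRing.maximalIdeal A) := Nat.card_pos
  exact (show 2 ≤ Nat.card (IsLocalRing.ResidueField A) - 1 by omega).trans
    (Nat.le_mul_of_pos_right _ hm)

theorem natCard_eq_two_of_natCard_units_eq_one {A : Type*} [CommRing A] [IsLocalRing A] [Finite A]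
    (h : Nat.card Aˣ = 1) : Nat.card A = 2 := by
  have h1 := natCard_eq_residueField_mul_maximalIdeal (A := A)
  have h2 := natCard_units_add_natCard_maximalIdeal (A := A)
  have h3 := natCard_units_eq_mul_natCard_maximalIdeal A
  rw [h] at h2 h3
  have := Nat.eq_one_of_mul_eq_one_left h3.symm
  omega

theorem natCard_eq_three_of_natCard_units_eq_two {A : Type*} [CommRing A] [IsLocalRing A]
    [Finite A] (h : Nat.card Aˣ = 2) (hq : Nat.card (IsLocalRing.ResidueField A) ≠ 2) :
    Nat.card A = 3 := by
  have h2 := natCard_units_add_natCard_maximalIdeal (A := A)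
  have h3 := natCard_units_eq_mul_natCard_maximalIdeal A
  have h4 := one_lt_natCard_residueField A
  rw [h] at h2 h3
  have hm : 0 < Nat.card (IsLocalRing.maximalIdeal A) := Nat.card_pos
  have hm1 : Nat.card (IsLocalRing.maximalIdeal A) = 1 := by
    by_contra hne
    have : 2 * 2 ≤ (Nat.card (IsLocalRing.ResidueField A) - 1)
      * Nat.card (IsLocalRing.maximalIdeal A) := Nat.mul_le_mul (by omega) (by omega)
    omega
  omega

theorem nonempty_ringEquiv_zmod {A : Type*} [CommRing A] [Finite A] {p : ℕ} (hp : p.Prime)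
    (h : Nat.card A = p) : Nonempty (A ≃+* ZMod p) := by
  have := Fintype.ofFinite A
  exact ⟨(ZMod.ringEquivOfPrime A hp (Nat.card_eq_fintype_card.symm.trans h)).symm⟩

/-- A finite product of finite local rings with exactly two units, one of the factors having
residue field of order at least three, is a product of copies of `𝔽₂` and one copy of `𝔽₃`. -/
theorem nonempty_ringEquiv_of_natCard_units_eq_two {s : ℕ} {A : Fin s → Type*}
    [∀ i, CommRing (A i)] [∀ i, IsLocalRing (A i)] [∀ i, Finite (A i)]
    (hd : ∏ i, Nat.card (A i)ˣ = 2) {j : Fin s}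
    (hj : Nat.card (IsLocalRing.ResidueField (A j)) ≠ 2) :
    Nonempty (((i : Fin s) → A i) ≃+* (Fin (s - 1) → ZMod 2) × ZMod 3) := by
  obtain _ | k := s
  · exact j.elim0
  have hj1 := one_lt_natCard_residueField (A j)
  have hj2 : 2 ≤ Nat.card (A j)ˣ := two_le_natCard_units (by omega)
  rw [Fin.prod_univ_succAbove _ j] at hd
  have hdj : Nat.card (A j)ˣ = 2 := le_antisymm (Nat.le_of_dvd two_pos ⟨_, hd.symm⟩) hj2
  rw [hdj] at hd
  have hd1 : ∏ i, Nat.card (A (j.succAbove i))ˣ = 1 := by omega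
  have h1 (i : Fin k) : Nat.card (A (j.succAbove i))ˣ = 1 :=
    Nat.dvd_one.1 (hd1 ▸ Finset.dvd_prod_of_mem _ (Finset.mem_univ i))
  obtain ⟨h⟩ := nonempty_ringEquiv_zmod Nat.prime_three
    (natCard_eq_three_of_natCard_units_eq_two hdj hj)
  have g (i : Fin k) : A (j.succAbove i) ≃+* ZMod 2 :=
    (nonempty_ringEquiv_zmod Nat.prime_two (natCard_eq_two_of_natCard_units_eq_one (h1 i))).some
  refine ⟨RingEquiv.ofBijective (RingHom.prod
    (RingHom.pi fun i => (g i).toRingHom.comp (Pi.evalRingHom A (j.succAbove i)))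
    (h.toRingHom.comp (Pi.evalRingHom A j))) ⟨fun x y hxy => ?_, fun z => ?_⟩⟩
  · obtain ⟨h2, h3⟩ := Prod.ext_iff.1 hxy
    funext i
    refine Fin.succAboveCases j ?_ (fun i => ?_) i
    · exact h.injective h3
    · exact (g i).injective (congrFun h2 i)
  · refine ⟨j.insertNth (h.symm z.2) fun i => (g i).symm (z.1 i), Prod.ext (funext fun i => ?_) ?_⟩
    · simp
    · simp

theorem theorem5p1 {R : Type*} [CommRing R] [Finite R] [Nontrivial R]
    (s : ℕ) (A : Fin s → Type*) [∀ i, CommRing (A i)] [∀ i, IsLocalRing (A i)]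
    (e : R ≃+* ((i : Fin s) → A i)) :
    (((∀ i, Nat.card (IsLocalRing.ResidueField (A i)) = 2) ∨
        Nonempty (R ≃+* (Fin (s - 1) → ZMod 2) × ZMod 3)) →
      graphEnergy (unitaryCayleyGraph R).lineGraph
        = 2 ^ (s + 1) * ((Nat.card Rˣ : ℝ) - 1) ^ 2) ∧
    (∀ t : ℕ, 1 ≤ t → t < s →
      Nat.card {i : Fin s // Nat.card (IsLocalRing.ResidueField (A i)) = 2} = t →
      ¬ Nonempty (R ≃+* (Fin (s - 1) → ZMod 2) × ZMod 3) →
      graphEnergy (unitaryCayleyGraph R).lineGraph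
        = 2 ^ (t + 1) + 2 * (Nat.card R : ℝ) * ((Nat.card Rˣ : ℝ) - 2)) ∧
    ((∀ i, 3 ≤ Nat.card (IsLocalRing.ResidueField (A i))) →
      ¬ Nonempty (R ≃+* ZMod 3) →
      graphEnergy (unitaryCayleyGraph R).lineGraph
        = 2 * (Nat.card R : ℝ) * ((Nat.card Rˣ : ℝ) - 2)) := by
  have hfin : Finite (∀ i, A i) := Finite.of_equiv R e.toEquiv
  have (i : Fin s) : Finite (A i) :=
    Finite.of_surjective _ (Function.surjective_eval (β := A) i)
  have hs : s ≠ 0 := by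
    rintro rfl
    exact not_subsingleton R (e.toEquiv.subsingleton)
  have hunits := natCard_units_eq_prod e
  have hcard : Nat.card R = ∏ i, Nat.card (A i) := by rw [Nat.card_congr e.toEquiv, Nat.card_pi]
  have hpos : 0 < Nat.card Rˣ := Nat.card_pos
  obtain ⟨d, hd⟩ : ∃ d, Nat.card Rˣ = d := ⟨_, rfl⟩
  have hle (i : Fin s) (hi : 3 ≤ Nat.card (IsLocalRing.ResidueField (A i))) : 2 ≤ d := by
    have h := Nat.le_of_dvd hpos (hunits ▸ Finset.dvd_prod_of_mem _ (Finset.mem_univ i))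
    exact (two_le_natCard_units hi).trans (hd ▸ h)
  have energy {t : ℕ} := graphEnergy_lineGraph_unitaryCayleyGraph (t := t) e (hd := hd)
  rw [hd] at hunits hpos ⊢
  refine ⟨?_, fun t ht1 hts ht hR => ?_, fun hq hR => ?_⟩
  · rintro (hq | ⟨⟨e'⟩⟩)
    · have hn : Nat.card R = 2 ^ s * d := by
        rw [hcard, hunits, ← Fin.prod_const, ← Finset.prod_mul_distrib]
        refine Finset.prod_congr rfl fun i _ => ?_
        rw [natCard_units_eq_mul_natCard_maximalIdeal, natCard_eq_residueField_mul_maximalIdeal,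
          hq i, Nat.add_one_sub_one, one_mul]
      obtain ⟨h1, h2, h3⟩ := energy (t := s) (by simp [hq])
      obtain hd' | hd' | hd' : d = 1 ∨ d = 2 ∨ 3 ≤ d := by omega
      · rw [h1 hd', hd']; norm_num
      · rw [h2 hd', hd']; norm_num
      · rw [h3 hd', hn, if_neg hs]
        push_cast
        ring
    · have hd2 : d = 2 := by
        rw [← hd, Nat.card_congr ((Units.mapEquiv e'.toMulEquiv).trans MulEquiv.prodUnits).toEquiv,
          Nat.card_prod, Nat.card_congr MulEquiv.piUnits.toEquiv, Nat.card_pi]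
        simp [ZMod.card_units_eq_totient, Nat.totient_prime Nat.prime_three]
      rw [(energy rfl).2.1 hd2, hd2]
      norm_num
  · obtain ⟨j, hj⟩ : ∃ j, Nat.card (IsLocalRing.ResidueField (A j)) ≠ 2 := by
      by_contra! h
      simp [h] at ht
      omega
    have hj1 := one_lt_natCard_residueField (A j)
    have hd2 : d ≠ 2 := fun h => by
      obtain ⟨e'⟩ := nonempty_ringEquiv_of_natCard_units_eq_two (hunits.symm.trans h) hj
      exact hR ⟨e.trans e'⟩
    have := hle j (by omega)
    rw [(energy ht).2.2 (by omega), if_neg (by omega)]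
    ring
  · have hj := hq ⟨0, by omega⟩
    have hd2 : d ≠ 2 := fun h => by
      obtain ⟨e'⟩ := nonempty_ringEquiv_of_natCard_units_eq_two (hunits.symm.trans h)
        (j := ⟨0, by omega⟩) (by omega)
      have h1 : 2 ^ s ≤ 2 ^ 1 := calc
        2 ^ s = ∏ _ : Fin s, 2 := (Fin.prod_const _ _).symm
        _ ≤ ∏ i, Nat.card (A i)ˣ :=
          Finset.prod_le_prod (fun _ _ => Nat.zero_le _) fun i _ => two_le_natCard_units (hq i)
        _ = 2 ^ 1 := by rw [← hunits, h, pow_one]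
      have h2 : s - 1 = 0 := by
        have := (Nat.pow_le_pow_iff_right one_lt_two).1 h1
        omega
      refine hR (nonempty_ringEquiv_zmod Nat.prime_three ?_)
      rw [Nat.card_congr (e.trans e').toEquiv, Nat.card_prod, Nat.card_pi, h2]
      simp
    have := hle _ hj
    have ht : Nat.card {i : Fin s // Nat.card (IsLocalRing.ResidueField (A i)) = 2} = 0 := by
      have : IsEmpty {i : Fin s // Nat.card (IsLocalRing.ResidueField (A i)) = 2} :=
        ⟨fun i => by have := hq i; have := i.2; omega⟩
      exact Nat.card_of_isEmpty
    rw [(energy ht).2.2 (by omega), if_pos rfl]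
    ring
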